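/- Let $R>0$ be a real number and $k\ge 2$ an integer. On $(0,1)$ put $$c_k=\frac{R^{3k-2}}{2^{(5k-3)/2}},\qquad w(t)=c_k\,t^{\frac{k-3}{2}}(1-t)^{k-2}(1+t),\qquad p(t)=\frac{4}{R^2}\,t(1-t)\,w(t),\qquad q(t)=R^2(1-t)\,w(t),$$ and consider the Sturm–Liouville equation $$-(pf')'+qf=\lambda w f\quad\text{on }(0,1),\qquad \lambda\in\mathbb{C}.\tag{SL}$$ A solution of (SL) is a function $f:(0,1)\to\mathbb{C}$ such that $f$ and $pf'$ are absolutely continuous on every compact subinterval of $(0,1)$ and (SL) holds almost everywhere. An endpoint $e\in\{0,1\}$ is called *regular* if $1/p$, $q$ and $w$ are integrable near $e$; otherwise it is *singular*. A singular endpoint $e$ is called a *limit circle* singularity if, for every $\lambda\in\mathbb{C}$, every solution $f$ of (SL) satisfies $\int |f|^2w\,dt<\infty$ near $e$, and a *limit point* singularity if, for every $\lambda\in\mathbb{C}$, there is a solution $f$ of (SL) with $\int |f|^2w\,dt=\infty$ over every one-sided neighbourhood of $e$ in $(0,1)$. Then: 1. the endpoint $t=0$ is regular if $k=2$, a limit circle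 singularity if $k=3$ or $k=4$, and a limit point singularity if $k\ge5$; 2. the endpoint $t=1$ is a limit circle singularity if $k=2$ and a limit point singularity if $k\ge3$. -/

import Mathlib

open MeasureTheory Set Filter Topology

namespace SturmLiouville

/-- `f` is absolutely continuous on every compact interval `[α, β] ⊆ (a, b)`. -/
def ACLoc (a b : ℝ) (f : ℝ → ℂ) : Prop :=
  ∀ α β : ℝ, a < α → α ≤ β → β < b → AbsolutelyContinuousOnInterval f α β

/-- `f` is a solution on `(a, b)` of the Sturm–Liouville equation `-(p f')' + q f = lam w f`:
both `f` and `p f'` are locally absolutely continuous on `(a, b)` and the equation holds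
almost everywhere on `(a, b)`. -/
def IsSolution (p q w : ℝ → ℝ) (a b : ℝ) (lam : ℂ) (f : ℝ → ℂ) : Prop :=
  ACLoc a b f ∧
  ACLoc a b (fun t => (p t : ℂ) * deriv f t) ∧
  ∀ᵐ t ∂(volume.restrict (Ioo a b)),
    -deriv (fun s => (p s : ℂ) * deriv f s) t + (q t : ℂ) * f t = lam * (w t : ℂ) * f t

/-- `|f|² w` is integrable on the part in `(a, b)` of some neighbourhood of the endpoint `e`. -/
def IsL2Near (w : ℝ → ℝ) (a b e : ℝ) (f : ℝ → ℂ) : Prop :=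
  IntegrableAtFilter (fun t => ‖f t‖ ^ 2 * w t) (𝓝[Ioo a b] e) volume

/-- The (finite) endpoint `e` of `(a, b)` is regular: `1 / p`, `q` and `w` are integrable on the
part in `(a, b)` of some neighbourhood of `e`. -/
def IsRegularEndpoint (p q w : ℝ → ℝ) (a b e : ℝ) : Prop :=
  IntegrableAtFilter (fun t => (p t)⁻¹) (𝓝[Ioo a b] e) volume ∧
  IntegrableAtFilter q (𝓝[Ioo a b] e) volume ∧
  IntegrableAtFilter w (𝓝[Ioo a b] e) volume

/-- The endpoint `e` is a limit circle singularity: it is not regular, and for every complex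
value of the spectral parameter all solutions are square integrable with weight `w` near `e`. -/
def IsLimitCircleEndpoint (p q w : ℝ → ℝ) (a b e : ℝ) : Prop :=
  ¬ IsRegularEndpoint p q w a b e ∧
  ∀ (lam : ℂ) (f : ℝ → ℂ), IsSolution p q w a b lam f → IsL2Near w a b e f

/-- The endpoint `e` is a limit point singularity: it is not regular, and for every complex
value of the spectral parameter some solution is not square integrable with weight `w` near `e`. -/
def IsLimitPointEndpoint (p q w : ℝ → ℝ) (a b e : ℝ) : Prop :=
  ¬ IsRegularEndpoint p q w a b e ∧
  ∀ lam : ℂ, ∃ f : ℝ → ℂ, IsSolution p q w a b lam f ∧ ¬ IsL2Near w a b e f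

end SturmLiouville

namespace RadialSchrodinger

/-- `c_k = R ^ (3 k - 2) / 2 ^ ((5 k - 3) / 2)`. -/
noncomputable def normConst (R : ℝ) (k : ℕ) : ℝ :=
  R ^ (3 * (k : ℝ) - 2) / 2 ^ ((5 * (k : ℝ) - 3) / 2)

/-- The weight `w^k(t) = c_k t ^ ((k - 3) / 2) (1 - t) ^ (k - 2) (1 + t)`. -/
noncomputable def weight (R : ℝ) (k : ℕ) (t : ℝ) : ℝ :=
  normConst R k * t ^ (((k : ℝ) - 3) / 2) * (1 - t) ^ ((k : ℤ) - 2) * (1 + t)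

/-- `p_k(t) = (4 / R ^ 2) t (1 - t) w^k(t)`. -/
noncomputable def coeffP (R : ℝ) (k : ℕ) (t : ℝ) : ℝ :=
  4 / R ^ 2 * t * (1 - t) * weight R k t

/-- `q_k(t) = R ^ 2 (1 - t) w^k(t)`. -/
noncomputable def coeffQ (R : ℝ) (k : ℕ) (t : ℝ) : ℝ :=
  R ^ 2 * (1 - t) * weight R k t

end RadialSchrodinger

/-!
Near each endpoint, in terms of the distance `s` to it, the coefficients have the form
`p = s ^ (β + 1) P`, `w = s ^ β W`, `q = s ^ β Q` with cofactors continuous up to the endpoint and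
`P`, `W` positive (`HasPowerBehaviour`). The exponent is `β = (k - 3) / 2` at `t = 0` and
`β = k - 2` at `t = 1`. The type of the endpoint depends on `β` alone: it is regular for
`-1 < β < 0`, limit circle for `0 ≤ β < 1` and limit point for `1 ≤ β`
(`HasPowerBehaviour.isRegularEndpoint`, `HasPowerBehaviour.isLimitCircleEndpoint`,
`HasPowerBehaviour.isLimitPointEndpoint`). Heuristically, the solutions behave like the solutions
`1` and `∫ 1 / p ~ s ^ (-β)` (a logarithm for `β = 0`) of `(p f')' = 0`, and
`s ^ (-2 β) w ~ s ^ (-β)` is integrable exactly for `β < 1`.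

To make this rigorous without asymptotic expansions, the equation is written as the system
`u' = v / p`, `v' = (q - lam w) u` with `v = p u'`. As the coefficients are continuous on `(0, 1)`,
the almost everywhere solutions are exactly the classical solutions of the system
(`IsSolution.isSystemSolution`, `IsSystemSolution.isSolution`). The central estimate is
`IsSystemSolution.norm_snd_sub_le`: on `(0, c]` with `c` small, `v` differs little from `v c`. The
bound on `v` gives `u = O(s ^ (-δ))` for any `δ > β` close to `β`, which settles the limit circle
case. In the limit point case the solution with `u c = 0`, `v c = 1` keeps `Re v ≥ 2 / 3`, so `|u|`
is bounded below by a multiple of `s ^ (-β)`. That this solution exists on all of `(0, 1)` is the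
global existence theorem `exists_hasDerivAt_linear` for linear equations. The endpoint `1` is
carried to `0` by the reflection `t ↦ 1 - t`.
-/

namespace SturmLiouville

/-! ### Absolutely continuous functions with a continuous derivative -/

/-- The fundamental theorem of calculus on an open interval, for an integrand which is continuous
there but possibly unbounded near the endpoints. -/
theorem hasDerivAt_integral_of_continuousOn_Ioo {E : Type*} [NormedAddCommGroup E]
    [NormedSpace ℝ E] [CompleteSpace E] {a b c t : ℝ} {h : ℝ → E}
    (hh : ContinuousOn h (Ioo a b)) (hc : c ∈ Ioo a b) (ht : t ∈ Ioo a b) :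
    HasDerivAt (fun x => ∫ s in c..x, h s) (h t) t := by
  have hsub : uIcc c t ⊆ Ioo a b := (convex_Ioo a b).ordConnected.uIcc_subset hc ht
  exact intervalIntegral.integral_hasDerivAt_right (hh.mono hsub).intervalIntegrable
    (hh.stronglyMeasurableAtFilter isOpen_Ioo t ht) (hh.continuousAt (isOpen_Ioo.mem_nhds ht))

theorem absolutelyContinuousOnInterval_of_hasDerivAt {E : Type*} [NormedAddCommGroup E]
    [NormedSpace ℝ E] {α β : ℝ} {F h : ℝ → E} (hF : ∀ t ∈ uIcc α β, HasDerivAt F (h t) t)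
    (hh : ContinuousOn h (uIcc α β)) : AbsolutelyContinuousOnInterval F α β := by
  obtain ⟨C, hC⟩ := isCompact_uIcc.exists_bound_of_continuousOn hh
  refine LipschitzOnWith.absolutelyContinuousOnInterval (K := C.toNNReal) ?_
  refine (convex_uIcc α β).lipschitzOnWith_of_nnnorm_hasDerivWithin_le
    (fun t ht => (hF t ht).hasDerivWithinAt) fun t ht => ?_
  rw [← NNReal.coe_le_coe, coe_nnnorm]
  exact (hC t ht).trans (Real.le_coe_toNNReal C)

theorem ACLoc.of_hasDerivAt {a b : ℝ} {F h : ℝ → ℂ}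
    (hF : ∀ t ∈ Ioo a b, HasDerivAt F (h t) t) (hh : ContinuousOn h (Ioo a b)) :
    ACLoc a b F := fun α β hα hαβ hβ => by
  have hsub : uIcc α β ⊆ Ioo a b :=
    (convex_Ioo a b).ordConnected.uIcc_subset ⟨hα, hαβ.trans_lt hβ⟩ ⟨hα.trans_le hαβ, hβ⟩
  exact absolutelyContinuousOnInterval_of_hasDerivAt (fun t ht => hF t (hsub ht)) (hh.mono hsub)

theorem ACLoc.continuousOn {a b : ℝ} {f : ℝ → ℂ} (hf : ACLoc a b f) :
    ContinuousOn f (Ioo a b) := fun t ht => by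
  obtain ⟨α, hα, hαt⟩ := exists_between ht.1
  obtain ⟨β, htβ, hβ⟩ := exists_between ht.2
  have h := (hf α β hα (hαt.trans htβ).le hβ).continuousOn
  rw [uIcc_of_le (hαt.trans htβ).le] at h
  exact (h.continuousAt (Icc_mem_nhds hαt htβ)).continuousWithinAt

/-- A locally absolutely continuous function whose derivative agrees almost everywhere with a
continuous function is continuously differentiable: subtracting a primitive of the continuous
function leaves an absolutely continuous function with derivative zero almost everywhere. -/
theorem ACLoc.hasDerivAt {a b : ℝ} {f h : ℝ → ℂ} (hf : ACLoc a b f)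
    (hh : ContinuousOn h (Ioo a b))
    (hfh : ∀ᵐ t ∂(volume.restrict (Ioo a b)), deriv f t = h t) {t : ℝ} (ht : t ∈ Ioo a b) :
    HasDerivAt f (h t) t := by
  obtain ⟨α, hα, hαt⟩ := exists_between ht.1
  obtain ⟨β, htβ, hβ⟩ := exists_between ht.2
  have hαβ : α ≤ β := (hαt.trans htβ).le
  have hαm : α ∈ Ioo a b := ⟨hα, hαβ.trans_lt hβ⟩
  have hsub : uIcc α β ⊆ Ioo a b :=
    (convex_Ioo a b).ordConnected.uIcc_subset hαm ⟨hα.trans_le hαβ, hβ⟩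
  set I : ℝ → ℂ := fun x => ∫ s in α..x, h s with hI
  have hIder : ∀ x ∈ Ioo a b, HasDerivAt I (h x) x := fun x hx =>
    hasDerivAt_integral_of_continuousOn_Ioo hh hαm hx
  have hIac : AbsolutelyContinuousOnInterval I α β :=
    absolutelyContinuousOnInterval_of_hasDerivAt (fun x hx => hIder x (hsub hx)) (hh.mono hsub)
  have hfac := hf α β hα hαβ hβ
  have hzero : ∀ᵐ x, x ∈ uIcc α β → HasDerivAt (fun y => f y - I y) 0 x := by
    rw [ae_restrict_iff' measurableSet_Ioo] at hfh
    filter_upwards [hfh, hfac.boundedVariationOn.ae_differentiableAt_of_mem_uIcc]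
      with x hx hdx hxm
    have h1 := (hdx hxm).hasDerivAt
    rw [hx (hsub hxm)] at h1
    exact (h1.sub (hIder x (hsub hxm))).congr_deriv (sub_self _)
  obtain ⟨C, hC⟩ := (hfac.fun_sub hIac).const_of_ae_hasDerivAt_zero hzero
  have heq : f =ᶠ[𝓝 t] fun x => C + I x := by
    filter_upwards [Icc_mem_nhds hαt htβ] with x hx
    rw [← hC x (by rwa [uIcc_of_le hαβ])]
    ring
  exact ((hIder t ht).const_add C).congr_of_eventuallyEq heq

/-! ### The equation as a first order system -/

/-- `(u, v)` is a classical solution on `(a, b)` of the first order system `u' = v / p`, `v' = g u`.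
For `g = q - lam w` this is the Sturm–Liouville equation for `u`, with `v` the quasi-derivative
`p u'`. -/
def IsSystemSolution (p : ℝ → ℝ) (g : ℝ → ℂ) (a b : ℝ) (u v : ℝ → ℂ) : Prop :=
  ∀ t ∈ Ioo a b, HasDerivAt u (v t / (p t : ℂ)) t ∧ HasDerivAt v (g t * u t) t

section System

variable {p q w : ℝ → ℝ} {a b : ℝ} {lam : ℂ}

/-- The coefficient `q - lam w` of the potential term. -/
noncomputable def potential (q w : ℝ → ℝ) (lam : ℂ) (t : ℝ) : ℂ := (q t : ℂ) - lam * (w t : ℂ)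

theorem continuousOn_potential (hq : ContinuousOn q (Ioo a b)) (hw : ContinuousOn w (Ioo a b)) :
    ContinuousOn (potential q w lam) (Ioo a b) :=
  (Complex.continuous_ofReal.comp_continuousOn hq).sub
    (continuousOn_const.mul (Complex.continuous_ofReal.comp_continuousOn hw))

theorem IsSolution.isSystemSolution (hp : ContinuousOn p (Ioo a b)) (hp0 : ∀ t ∈ Ioo a b, 0 < p t)
    (hq : ContinuousOn q (Ioo a b)) (hw : ContinuousOn w (Ioo a b)) {f : ℝ → ℂ}
    (hf : IsSolution p q w a b lam f) :
    IsSystemSolution p (potential q w lam) a b f (fun t => (p t : ℂ) * deriv f t) := by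
  obtain ⟨hf1, hf2, heq⟩ := hf
  have hpne : ∀ t ∈ Ioo a b, (p t : ℂ) ≠ 0 := fun t ht =>
    Complex.ofReal_ne_zero.2 (hp0 t ht).ne'
  intro t ht
  refine ⟨hf1.hasDerivAt (h := fun t => (p t : ℂ) * deriv f t / (p t : ℂ)) ?_ ?_ ht,
    hf2.hasDerivAt (h := fun t => potential q w lam t * f t) ?_ ?_ ht⟩
  · exact hf2.continuousOn.div (Complex.continuous_ofReal.comp_continuousOn hp) hpne
  · filter_upwards [ae_restrict_mem measurableSet_Ioo] with s hs
    rw [mul_div_cancel_left₀ _ (hpne s hs)]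
  · exact (continuousOn_potential hq hw).mul hf1.continuousOn
  · filter_upwards [heq] with s hs
    simp only [potential]
    linear_combination -hs

theorem IsSystemSolution.isSolution (hp : ContinuousOn p (Ioo a b)) (hp0 : ∀ t ∈ Ioo a b, 0 < p t)
    (hq : ContinuousOn q (Ioo a b)) (hw : ContinuousOn w (Ioo a b)) {u v : ℝ → ℂ}
    (h : IsSystemSolution p (potential q w lam) a b u v) : IsSolution p q w a b lam u := by
  have hpne : ∀ t ∈ Ioo a b, (p t : ℂ) ≠ 0 := fun t ht =>
    Complex.ofReal_ne_zero.2 (hp0 t ht).ne'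
  have hu : ContinuousOn u (Ioo a b) := fun t ht => (h t ht).1.continuousAt.continuousWithinAt
  have hv : ContinuousOn v (Ioo a b) := fun t ht => (h t ht).2.continuousAt.continuousWithinAt
  have hquasi : ∀ t ∈ Ioo a b, HasDerivAt (fun t => (p t : ℂ) * deriv u t)
      (potential q w lam t * u t) t := fun t ht => by
    refine (h t ht).2.congr_of_eventuallyEq ?_
    filter_upwards [isOpen_Ioo.mem_nhds ht] with s hs
    rw [(h s hs).1.deriv, mul_div_cancel₀ _ (hpne s hs)]
  refine ⟨ACLoc.of_hasDerivAt (fun t ht => (h t ht).1) ?_, ACLoc.of_hasDerivAt hquasi ?_, ?_⟩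
  · exact hv.div (Complex.continuous_ofReal.comp_continuousOn hp) hpne
  · exact (continuousOn_potential hq hw).mul hu
  · filter_upwards [ae_restrict_mem measurableSet_Ioo] with t ht
    rw [(hquasi t ht).deriv]
    simp only [potential]
    ring

end System

/-! ### Global solutions of linear differential equations on an open interval -/

section Picard

variable {E : Type*} [NormedAddCommGroup E] [NormedSpace ℝ E]

/-- The `n`-fold iterated integral in the Picard (Peano–Baker) series of `x' = A x`,
`x c = x₀`. -/
noncomputable def picardTerm (A : ℝ → E →L[ℝ] E) (c : ℝ) (x₀ : E) : ℕ → ℝ → E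
  | 0 => fun _ => x₀
  | n + 1 => fun t => ∫ s in c..t, A s (picardTerm A c x₀ n s)

theorem norm_picardTerm_le {A : ℝ → E →L[ℝ] E} {c α β K : ℝ} {x₀ : E}
    (hK : ∀ t ∈ Icc α β, ‖A t‖ ≤ K) (hc : c ∈ Icc α β) (n : ℕ) {t : ℝ} (ht : t ∈ Icc α β) :
    ‖picardTerm A c x₀ n t‖ ≤ ‖x₀‖ * ((K * |t - c|) ^ n / n.factorial) := by
  have hK0 : 0 ≤ K := (norm_nonneg _).trans (hK c hc)
  induction n generalizing t with
  | zero => simp [picardTerm]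
  | succ n ih =>
    have hsub : uIoc c t ⊆ Icc α β :=
      uIoc_subset_uIcc.trans ((convex_Icc α β).ordConnected.uIcc_subset hc ht)
    have hint : ∀ s ∈ uIoc c t, ‖A s (picardTerm A c x₀ n s)‖ ≤
        ‖x₀‖ * K ^ (n + 1) / n.factorial * |s - c| ^ n := fun s hs => by
      calc ‖A s (picardTerm A c x₀ n s)‖
          ≤ ‖A s‖ * ‖picardTerm A c x₀ n s‖ := (A s).le_opNorm _
        _ ≤ K * (‖x₀‖ * ((K * |s - c|) ^ n / n.factorial)) :=
            mul_le_mul (hK s (hsub hs)) (ih (hsub hs)) (norm_nonneg _) hK0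
        _ = ‖x₀‖ * K ^ (n + 1) / n.factorial * |s - c| ^ n := by rw [mul_pow]; ring
    have hcont : IntegrableOn
        (fun s => ‖x₀‖ * K ^ (n + 1) / n.factorial * |s - c| ^ n) (uIoc c t) :=
      intervalIntegrable_iff.1 (Continuous.intervalIntegrable (by fun_prop) c t)
    calc ‖picardTerm A c x₀ (n + 1) t‖
        ≤ ∫ s in uIoc c t, ‖A s (picardTerm A c x₀ n s)‖ :=
          intervalIntegral.norm_integral_le_integral_norm_uIoc
      _ ≤ ∫ s in uIoc c t, ‖x₀‖ * K ^ (n + 1) / n.factorial * |s - c| ^ n := by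
          refine integral_mono_of_nonneg (Eventually.of_forall fun s => norm_nonneg _) hcont ?_
          exact (ae_restrict_iff' measurableSet_uIoc).2 (Eventually.of_forall hint)
      _ = ‖x₀‖ * ((K * |t - c|) ^ (n + 1) / (n + 1).factorial) := by
          rw [integral_const_mul, integral_pow_abs_sub_uIoc, Nat.factorial_succ, mul_pow]
          push_cast
          have := Nat.cast_ne_zero (R := ℝ).2 n.factorial_ne_zero
          field_simp

variable [CompleteSpace E] {A : ℝ → E →L[ℝ] E} {a b c : ℝ} {x₀ : E}

theorem continuousOn_picardTerm (hA : ContinuousOn A (Ioo a b)) (hc : c ∈ Ioo a b) (n : ℕ) :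
    ContinuousOn (picardTerm A c x₀ n) (Ioo a b) := by
  induction n with
  | zero => exact continuousOn_const
  | succ n ih =>
    intro t ht
    exact (hasDerivAt_integral_of_continuousOn_Ioo (hA.clm_apply ih) hc
      ht).continuousAt.continuousWithinAt

theorem hasDerivAt_picardTerm (hA : ContinuousOn A (Ioo a b)) (hc : c ∈ Ioo a b) (n : ℕ) {t : ℝ}
    (ht : t ∈ Ioo a b) :
    HasDerivAt (picardTerm A c x₀ (n + 1)) (A t (picardTerm A c x₀ n t)) t :=
  hasDerivAt_integral_of_continuousOn_Ioo
    (hA.clm_apply (continuousOn_picardTerm hA hc n)) hc ht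

/-- A linear differential equation with continuous coefficients on an open interval has a solution
on the whole interval. The solution is the sum of the Picard series, which together with its
termwise derivative converges uniformly on every compact subinterval. -/
theorem exists_hasDerivAt_linear (hA : ContinuousOn A (Ioo a b)) (hc : c ∈ Ioo a b) (x₀ : E) :
    ∃ x : ℝ → E, x c = x₀ ∧ ∀ t ∈ Ioo a b, HasDerivAt x (A t (x t)) t := by
  refine ⟨fun t => x₀ + ∑' n, picardTerm A c x₀ (n + 1) t, ?_, fun t ht => ?_⟩
  · simp [picardTerm]
  obtain ⟨α, hα, hαm⟩ := exists_between (lt_min hc.1 ht.1)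
  obtain ⟨β, hβm, hβ⟩ := exists_between (max_lt hc.2 ht.2)
  have hcI : c ∈ Ioo α β := ⟨hαm.trans_le (min_le_left _ _), (le_max_left _ _).trans_lt hβm⟩
  have htI : t ∈ Ioo α β := ⟨hαm.trans_le (min_le_right _ _), (le_max_right _ _).trans_lt hβm⟩
  have hsub : Icc α β ⊆ Ioo a b := fun s hs => ⟨hα.trans_le hs.1, hs.2.trans_lt hβ⟩
  obtain ⟨K, hK⟩ := isCompact_Icc.exists_bound_of_continuousOn (hA.mono hsub)
  have hK0 : 0 ≤ K := (norm_nonneg _).trans (hK c (Ioo_subset_Icc_self hcI))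
  set r : ℕ → ℝ := fun n => ‖x₀‖ * ((K * (β - α)) ^ n / n.factorial) with hr
  have hrsum : Summable r := (Real.summable_pow_div_factorial _).mul_left _
  have hbound : ∀ n, ∀ s ∈ Ioo α β, ‖picardTerm A c x₀ n s‖ ≤ r n := fun n s hs => by
    refine (norm_picardTerm_le hK (Ioo_subset_Icc_self hcI) n (Ioo_subset_Icc_self hs)).trans ?_
    have : |s - c| ≤ β - α := abs_le.2 ⟨by linarith [hs.1, hcI.2], by linarith [hs.2, hcI.1]⟩
    simp only [hr]
    gcongr
  have hsumm : Summable fun n => picardTerm A c x₀ n t :=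
    .of_norm_bounded hrsum fun n => hbound n t htI
  have hder := hasDerivAt_tsum_of_isPreconnected (𝕜 := ℝ) (u := fun n => K * r n)
    (g := fun n => picardTerm A c x₀ (n + 1)) (g' := fun n s => A s (picardTerm A c x₀ n s))
    (hrsum.mul_left K) isOpen_Ioo isPreconnected_Ioo
    (fun n s hs => hasDerivAt_picardTerm hA hc n (hsub (Ioo_subset_Icc_self hs)))
    (fun n s hs => ((A s).le_opNorm _).trans
      (mul_le_mul (hK s (Ioo_subset_Icc_self hs)) (hbound n s hs) (norm_nonneg _) hK0))
    htI ((summable_nat_add_iff 1).2 hsumm) htI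
  have hval : A t (x₀ + ∑' n, picardTerm A c x₀ (n + 1) t) =
      ∑' n, A t (picardTerm A c x₀ n t) := by
    rw [← (A t).map_tsum hsumm, hsumm.tsum_eq_zero_add]
    rfl
  rw [hval]
  exact hder.const_add x₀

end Picard

theorem exists_isSystemSolution {p : ℝ → ℝ} {g : ℝ → ℂ} {a b c : ℝ}
    (hp : ContinuousOn p (Ioo a b)) (hp0 : ∀ t ∈ Ioo a b, 0 < p t)
    (hg : ContinuousOn g (Ioo a b)) (hc : c ∈ Ioo a b) (u₀ v₀ : ℂ) :
    ∃ u v : ℝ → ℂ, u c = u₀ ∧ v c = v₀ ∧ IsSystemSolution p g a b u v := by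
  set A : ℝ → (ℂ × ℂ) →L[ℝ] (ℂ × ℂ) := fun t =>
    (p t)⁻¹ • (ContinuousLinearMap.inl ℝ ℂ ℂ ∘L ContinuousLinearMap.snd ℝ ℂ ℂ) +
      ContinuousLinearMap.inr ℝ ℂ ℂ ∘L (ContinuousLinearMap.mul ℝ ℂ (g t)) ∘L
        ContinuousLinearMap.fst ℝ ℂ ℂ with hAdef
  have hA : ContinuousOn A (Ioo a b) := by
    refine ((hp.inv₀ fun t ht => (hp0 t ht).ne').smul continuousOn_const).add ?_
    refine continuousOn_const.clm_comp (ContinuousOn.clm_comp ?_ continuousOn_const)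
    exact (ContinuousLinearMap.mul ℝ ℂ).continuous.comp_continuousOn hg
  obtain ⟨x, hxc, hx⟩ := exists_hasDerivAt_linear hA hc (u₀, v₀)
  refine ⟨fun t => (x t).1, fun t => (x t).2, by simp [hxc], by simp [hxc], fun t ht => ?_⟩
  have hfst := (ContinuousLinearMap.fst ℝ ℂ ℂ).hasFDerivAt.comp_hasDerivAt t (hx t ht)
  have hsnd := (ContinuousLinearMap.snd ℝ ℂ ℂ).hasFDerivAt.comp_hasDerivAt t (hx t ht)
  refine ⟨hfst.congr_deriv ?_, hsnd.congr_deriv ?_⟩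
  · simp [hAdef, div_eq_inv_mul]
  · simp [hAdef]

/-! ### Integrability of powers near the endpoint `0` -/

theorem integrableAtFilter_zero_of_norm_le_rpow {E : Type*} [NormedAddCommGroup E] {F : ℝ → E}
    {C c r : ℝ} (hF : ContinuousOn F (Ioo 0 1)) (hc : c ∈ Ioo (0 : ℝ) 1) (hr : -1 < r)
    (hb : ∀ t ∈ Ioo 0 c, ‖F t‖ ≤ C * t ^ r) :
    IntegrableAtFilter F (𝓝[Ioo (0 : ℝ) 1] 0) volume := by
  refine ⟨Ioo 0 c, ?_, ?_⟩
  · rw [nhdsWithin_Ioo_eq_nhdsGT zero_lt_one]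
    exact Ioo_mem_nhdsGT hc.1
  · refine Integrable.mono'
      (((intervalIntegral.integrableOn_Ioo_rpow_iff hc.1).2 hr).integrable.const_mul C)
      ((hF.mono (Ioo_subset_Ioo_right hc.2.le)).aestronglyMeasurable measurableSet_Ioo) ?_
    exact (ae_restrict_iff' measurableSet_Ioo).2 (Eventually.of_forall hb)

theorem not_integrableAtFilter_zero_of_rpow_le_norm {E : Type*} [NormedAddCommGroup E] {F : ℝ → E}
    {κ c r : ℝ} (hc : 0 < c) (hκ : 0 < κ) (hr : r ≤ -1)
    (hb : ∀ t ∈ Ioo 0 c, κ * t ^ r ≤ ‖F t‖) :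
    ¬ IntegrableAtFilter F (𝓝[Ioo (0 : ℝ) 1] 0) volume := by
  rintro ⟨s, hs, hint⟩
  rw [nhdsWithin_Ioo_eq_nhdsGT zero_lt_one] at hs
  obtain ⟨ε, hε, hεs⟩ := mem_nhdsGT_iff_exists_Ioo_subset.1 hs
  have hm : 0 < min ε c := lt_min hε hc
  have hint' : IntegrableOn F (Ioo 0 (min ε c)) :=
    hint.mono_set ((Ioo_subset_Ioo_right (min_le_left _ _)).trans hεs)
  refine absurd ((intervalIntegral.integrableOn_Ioo_rpow_iff (s := r) hm).1 ?_) hr.not_gt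
  refine Integrable.mono' (hint'.integrable.norm.const_mul κ⁻¹)
    (by fun_prop : Measurable fun t : ℝ => t ^ r).aestronglyMeasurable ?_
  refine (ae_restrict_iff' measurableSet_Ioo).2 (Eventually.of_forall fun t ht => ?_)
  rw [Real.norm_of_nonneg (Real.rpow_nonneg ht.1.le r), inv_mul_eq_div, le_div_iff₀' hκ]
  exact hb t ⟨ht.1, ht.2.trans_le (min_le_right _ _)⟩

/-! ### A priori estimates for the system near the endpoint `0` -/

theorem norm_sub_le_of_norm_hasDerivAt_le {E : Type*} [NormedAddCommGroup E] [NormedSpace ℝ E]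
    {F F' : ℝ → E} {G G' : ℝ → ℝ} {t c : ℝ} (htc : t ≤ c)
    (hF : ∀ s ∈ Icc t c, HasDerivAt F (F' s) s) (hG : ∀ s ∈ Icc t c, HasDerivAt G (G' s) s)
    (h : ∀ s ∈ Icc t c, ‖F' s‖ ≤ G' s) : ‖F c - F t‖ ≤ G c - G t := by
  refine image_norm_le_of_norm_deriv_right_le_deriv_boundary' (f := fun s => F s - F t)
    (B := fun s => G s - G t) (f' := F') (B' := G') (a := t) (b := c)
    ?_ ?_ (by simp) ?_ ?_ ?_ (right_mem_Icc.2 htc)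
  · exact fun s hs => ((hF s hs).sub_const _).continuousAt.continuousWithinAt
  · exact fun s hs => ((hF s (Ico_subset_Icc_self hs)).sub_const _).hasDerivWithinAt
  · exact fun s hs => ((hG s hs).sub_const _).continuousAt.continuousWithinAt
  · exact fun s hs => ((hG s (Ico_subset_Icc_self hs)).sub_const _).hasDerivWithinAt
  · exact fun s hs => h s (Ico_subset_Icc_self hs)

section Estimates

variable {p : ℝ → ℝ} {g u v : ℝ → ℂ} {A B c δ : ℝ}

/-- A bound for `v` turns into a power bound for `u`, by integrating `u' = v / p`. -/
theorem IsSystemSolution.norm_fst_le (h : IsSystemSolution p g 0 1 u v) (hδ : 0 < δ)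
    (hA : 0 ≤ A) (hc : c ∈ Ioo (0 : ℝ) 1) (hp0 : ∀ t ∈ Ioo (0 : ℝ) 1, 0 < p t)
    (hp : ∀ t ∈ Ioc 0 c, (p t)⁻¹ ≤ A * t ^ (-δ - 1)) {t m : ℝ} (ht : t ∈ Ioc 0 c)
    (hm : ∀ s ∈ Icc t c, ‖v s‖ ≤ m) : ‖u t‖ ≤ (‖u c‖ + m * A / δ) * t ^ (-δ) := by
  have hm0 : 0 ≤ m := (norm_nonneg _).trans (hm c (right_mem_Icc.2 ht.2))
  have hpos : ∀ s ∈ Icc t c, 0 < s := fun s hs => ht.1.trans_le hs.1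
  have hmem : ∀ s ∈ Icc t c, s ∈ Ioo (0 : ℝ) 1 := fun s hs => ⟨hpos s hs, hs.2.trans_lt hc.2⟩
  have key := norm_sub_le_of_norm_hasDerivAt_le (F := u) (F' := fun s => v s / (p s : ℂ))
    (G := fun s => -(m * A / δ) * s ^ (-δ)) (G' := fun s => m * (A * s ^ (-δ - 1))) ht.2
    (fun s hs => (h s (hmem s hs)).1)
    (fun s hs => by
      refine ((Real.hasDerivAt_rpow_const (Or.inl (hpos s hs).ne')).const_mul _).congr_deriv ?_
      field_simp)
    (fun s hs => by
      rw [norm_div, Complex.norm_real, Real.norm_of_nonneg (hp0 s (hmem s hs)).le, div_eq_mul_inv]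
      exact mul_le_mul (hm s hs) (hp s ⟨hpos s hs, hs.2⟩)
        (inv_nonneg.2 (hp0 s (hmem s hs)).le) hm0)
  have hone : 1 ≤ t ^ (-δ) :=
    Real.one_le_rpow_of_pos_of_le_one_of_nonpos ht.1 (ht.2.trans hc.2.le) (by linarith)
  have hcnn : 0 ≤ m * A / δ * c ^ (-δ) := by
    have := hc.1.le
    positivity
  have htri : ‖u t‖ ≤ ‖u c‖ + ‖u c - u t‖ := by
    calc ‖u t‖ = ‖u c - (u c - u t)‖ := by congr 1; ring
      _ ≤ _ := norm_sub_le _ _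
  have := mul_le_mul_of_nonneg_left hone (norm_nonneg (u c))
  linarith

/-- If `1 / p = O(t ^ (-δ - 1))`, `g = O(t ^ (δ - 1 / 2))` and `c` is small in terms of the
constants, then on `(0, c]` the component `v` stays close to its value at `c`. With `m` the maximum
of `|v|` on `[t, c]`, integrating `u' = v / p` and then `v' = g u` gives back
`|v - v c| ≤ X + m / 4` with `X = 2 * B * √c * |u c|`, which bounds `m`. -/
theorem IsSystemSolution.norm_snd_sub_le (h : IsSystemSolution p g 0 1 u v) (hδ : 0 < δ)
    (hA : 0 ≤ A) (hB : 0 ≤ B) (hc : c ∈ Ioo (0 : ℝ) 1) (hp0 : ∀ t ∈ Ioo (0 : ℝ) 1, 0 < p t)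
    (hp : ∀ t ∈ Ioc 0 c, (p t)⁻¹ ≤ A * t ^ (-δ - 1))
    (hg : ∀ t ∈ Ioc 0 c, ‖g t‖ ≤ B * t ^ (δ - 1 / 2))
    (hsmall : 2 * B * (A / δ) * c ^ (1 / 2 : ℝ) ≤ 1 / 4) {t : ℝ} (ht : t ∈ Ioc 0 c) :
    ‖v t - v c‖ ≤ ‖v c‖ / 3 + 4 / 3 * (2 * B * c ^ (1 / 2 : ℝ) * ‖u c‖) := by
  have hpos : ∀ s ∈ Icc t c, 0 < s := fun s hs => ht.1.trans_le hs.1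
  have hmem : ∀ s ∈ Icc t c, s ∈ Ioo (0 : ℝ) 1 := fun s hs => ⟨hpos s hs, hs.2.trans_lt hc.2⟩
  have hvcont : ContinuousOn (fun s => ‖v s‖) (Icc t c) := fun s hs =>
    (h s (hmem s hs)).2.continuousAt.norm.continuousWithinAt
  obtain ⟨t₀, ht₀, hmax⟩ := isCompact_Icc.exists_isMaxOn (nonempty_Icc.2 ht.2) hvcont
  set m := ‖v t₀‖ with hmdef
  have hm : ∀ s ∈ Icc t c, ‖v s‖ ≤ m := fun s hs => hmax hs
  set D := ‖u c‖ + m * A / δ with hD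
  have hD0 : 0 ≤ D := by positivity
  have hdiff : ∀ s ∈ Icc t c, ‖v s - v c‖ ≤ 2 * B * c ^ (1 / 2 : ℝ) * ‖u c‖ + m / 4 := by
    intro s hs
    have hsub : Icc s c ⊆ Icc t c := Icc_subset_Icc_left hs.1
    have key := norm_sub_le_of_norm_hasDerivAt_le (F := v) (F' := fun x => g x * u x)
      (G := fun x => 2 * B * D * x ^ (1 / 2 : ℝ)) (G' := fun x => B * D * x ^ (-1 / 2 : ℝ)) hs.2
      (fun x hx => (h x (hmem x (hsub hx))).2)
      (fun x hx => by
        refine ((Real.hasDerivAt_rpow_const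
          (Or.inl (hpos x (hsub hx)).ne')).const_mul _).congr_deriv ?_
        norm_num
        ring)
      (fun x hx => by
        have hx0 := hpos x (hsub hx)
        have hxc : x ∈ Ioc 0 c := ⟨hx0, hx.2⟩
        have hux := h.norm_fst_le hδ hA hc hp0 hp hxc
          fun y hy => hm y ⟨hs.1.trans (hx.1.trans hy.1), hy.2⟩
        calc ‖g x * u x‖ = ‖g x‖ * ‖u x‖ := norm_mul _ _
          _ ≤ (B * x ^ (δ - 1 / 2)) * (D * x ^ (-δ)) :=
            mul_le_mul (hg x hxc) hux (norm_nonneg _) (by positivity)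
          _ = B * D * (x ^ (δ - 1 / 2) * x ^ (-δ)) := by ring
          _ = B * D * x ^ (-1 / 2 : ℝ) := by
            rw [← Real.rpow_add hx0]
            congr 2
            ring)
    have hsnn : 0 ≤ 2 * B * D * s ^ (1 / 2 : ℝ) := by
      have := (hpos s hs).le
      positivity
    have hm4 : 2 * B * (A / δ) * c ^ (1 / 2 : ℝ) * m ≤ 1 / 4 * m :=
      mul_le_mul_of_nonneg_right hsmall (norm_nonneg _)
    have hexp : 2 * B * D * c ^ (1 / 2 : ℝ) = 2 * B * c ^ (1 / 2 : ℝ) * ‖u c‖ +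
        2 * B * (A / δ) * c ^ (1 / 2 : ℝ) * m := by rw [hD]; ring
    rw [norm_sub_rev]
    linarith
  have h0 := hdiff t₀ ht₀
  have h1 := norm_sub_norm_le (v t₀) (v c)
  have h2 := hdiff t (left_mem_Icc.2 ht.2)
  linarith

end Estimates

theorem exists_small_mul_sqrt_le (X : ℝ) :
    ∃ c ∈ Ioo (0 : ℝ) (1 / 2), X * c ^ (1 / 2 : ℝ) ≤ 1 / 4 := by
  have hlim : Tendsto (fun c : ℝ => X * c ^ (1 / 2 : ℝ)) (𝓝[>] 0) (𝓝 0) := by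
    have h : ContinuousAt (fun c : ℝ => X * c ^ (1 / 2 : ℝ)) 0 :=
      (Real.continuousAt_rpow_const 0 _ (Or.inr (by norm_num))).const_mul X
    have h' := h.tendsto.mono_left (nhdsWithin_le_nhds (s := Ioi 0))
    simpa using h'
  have hev := (hlim.eventually_le_const (by norm_num : (0 : ℝ) < 1 / 4)).and
    (Ioo_mem_nhdsGT (by norm_num : (0 : ℝ) < 1 / 2))
  obtain ⟨c, hc, hcm⟩ := hev.exists
  exact ⟨c, hcm, hc⟩

/-! ### Classification of an endpoint with power behaviour -/

/-- The coefficients on `(0, 1)` behave near `0` like the powers `p ~ t ^ (β + 1)`, `w ~ t ^ β`,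
`q = O(t ^ β)`, in the sense that the cofactors `P`, `W`, `Q` of these powers extend continuously to
`[0, 1 / 2]`, with `P` and `W` positive there. -/
structure HasPowerBehaviour (p q w : ℝ → ℝ) (β : ℝ) (P Q W : ℝ → ℝ) : Prop where
  continuousOn_p : ContinuousOn p (Ioo 0 1)
  continuousOn_q : ContinuousOn q (Ioo 0 1)
  continuousOn_w : ContinuousOn w (Ioo 0 1)
  p_pos : ∀ t ∈ Ioo (0 : ℝ) 1, 0 < p t
  continuousOn_P : ContinuousOn P (Icc 0 (1 / 2))
  continuousOn_Q : ContinuousOn Q (Icc 0 (1 / 2))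
  continuousOn_W : ContinuousOn W (Icc 0 (1 / 2))
  P_pos : ∀ t ∈ Icc (0 : ℝ) (1 / 2), 0 < P t
  W_pos : ∀ t ∈ Icc (0 : ℝ) (1 / 2), 0 < W t
  p_eq : ∀ t ∈ Ioo (0 : ℝ) 1, p t = t ^ (β + 1) * P t
  q_eq : ∀ t ∈ Ioo (0 : ℝ) 1, q t = t ^ β * Q t
  w_eq : ∀ t ∈ Ioo (0 : ℝ) 1, w t = t ^ β * W t

theorem exists_bounds_of_continuousOn_pos {P : ℝ → ℝ} (hP : ContinuousOn P (Icc 0 (1 / 2)))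
    (hpos : ∀ t ∈ Icc (0 : ℝ) (1 / 2), 0 < P t) :
    ∃ m M : ℝ, 0 < m ∧ 0 < M ∧ ∀ t ∈ Icc (0 : ℝ) (1 / 2), m ≤ P t ∧ P t ≤ M := by
  have hne : (Icc (0 : ℝ) (1 / 2)).Nonempty := nonempty_Icc.2 (by norm_num)
  obtain ⟨x, hx, hmin⟩ := isCompact_Icc.exists_isMinOn hne hP
  obtain ⟨y, hy, hmax⟩ := isCompact_Icc.exists_isMaxOn hne hP
  exact ⟨P x, P y, hpos x hx, hpos y hy, fun t ht => ⟨hmin ht, hmax ht⟩⟩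

namespace HasPowerBehaviour

variable {p q w P Q W : ℝ → ℝ} {β : ℝ}

theorem exists_inv_p_bounds (h : HasPowerBehaviour p q w β P Q W) :
    ∃ κ A : ℝ, 0 < κ ∧ 0 < A ∧ ∀ t ∈ Ioo (0 : ℝ) (1 / 2),
      κ * t ^ (-β - 1) ≤ (p t)⁻¹ ∧ (p t)⁻¹ ≤ A * t ^ (-β - 1) := by
  obtain ⟨m, M, hm, hM, hb⟩ := exists_bounds_of_continuousOn_pos h.continuousOn_P h.P_pos
  refine ⟨M⁻¹, m⁻¹, inv_pos.2 hM, inv_pos.2 hm, fun t ht => ?_⟩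
  have hbt := hb t (Ioo_subset_Icc_self ht)
  have hinv : (p t)⁻¹ = (P t)⁻¹ * t ^ (-β - 1) := by
    rw [h.p_eq t ⟨ht.1, by linarith [ht.2]⟩, mul_inv, ← Real.rpow_neg ht.1.le, mul_comm]
    congr 2
    ring
  have hnn := Real.rpow_nonneg ht.1.le (-β - 1)
  rw [hinv]
  exact ⟨mul_le_mul_of_nonneg_right (inv_anti₀ (hm.trans_le hbt.1) hbt.2) hnn,
    mul_le_mul_of_nonneg_right (inv_anti₀ hm hbt.1) hnn⟩

theorem exists_w_bounds (h : HasPowerBehaviour p q w β P Q W) :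
    ∃ κ B : ℝ, 0 < κ ∧ 0 < B ∧ ∀ t ∈ Ioo (0 : ℝ) (1 / 2), κ * t ^ β ≤ w t ∧ w t ≤ B * t ^ β := by
  obtain ⟨m, M, hm, hM, hb⟩ := exists_bounds_of_continuousOn_pos h.continuousOn_W h.W_pos
  refine ⟨m, M, hm, hM, fun t ht => ?_⟩
  have hbt := hb t (Ioo_subset_Icc_self ht)
  have hnn := Real.rpow_nonneg ht.1.le β
  rw [h.w_eq t ⟨ht.1, by linarith [ht.2]⟩, mul_comm (t ^ β)]
  exact ⟨mul_le_mul_of_nonneg_right hbt.1 hnn, mul_le_mul_of_nonneg_right hbt.2 hnn⟩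

theorem exists_q_bound (h : HasPowerBehaviour p q w β P Q W) :
    ∃ B : ℝ, 0 ≤ B ∧ ∀ t ∈ Ioo (0 : ℝ) (1 / 2), ‖q t‖ ≤ B * t ^ β := by
  obtain ⟨M, hM⟩ := isCompact_Icc.exists_bound_of_continuousOn h.continuousOn_Q
  refine ⟨M, (norm_nonneg _).trans (hM 0 (left_mem_Icc.2 (by norm_num))), fun t ht => ?_⟩
  have hnn := Real.rpow_nonneg ht.1.le β
  rw [h.q_eq t ⟨ht.1, by linarith [ht.2]⟩, norm_mul, Real.norm_of_nonneg hnn, mul_comm]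
  exact mul_le_mul_of_nonneg_right (hM t (Ioo_subset_Icc_self ht)) hnn

theorem exists_potential_bound (h : HasPowerBehaviour p q w β P Q W) (lam : ℂ) :
    ∃ B : ℝ, 0 ≤ B ∧ ∀ t ∈ Ioo (0 : ℝ) (1 / 2), ‖potential q w lam t‖ ≤ B * t ^ β := by
  obtain ⟨Bq, hBq, hq⟩ := h.exists_q_bound
  obtain ⟨κ, Bw, hκ, hBw, hw⟩ := h.exists_w_bounds
  refine ⟨Bq + ‖lam‖ * Bw, by positivity, fun t ht => ?_⟩
  have hw0 : 0 ≤ w t := (mul_nonneg hκ.le (Real.rpow_nonneg ht.1.le β)).trans (hw t ht).1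
  calc ‖potential q w lam t‖ ≤ ‖(q t : ℂ)‖ + ‖lam * (w t : ℂ)‖ := norm_sub_le _ _
    _ = ‖q t‖ + ‖lam‖ * w t := by
      rw [norm_mul, Complex.norm_real, Complex.norm_real, Real.norm_of_nonneg hw0]
    _ ≤ Bq * t ^ β + ‖lam‖ * (Bw * t ^ β) :=
      add_le_add (hq t ht) (mul_le_mul_of_nonneg_left (hw t ht).2 (norm_nonneg _))
    _ = (Bq + ‖lam‖ * Bw) * t ^ β := by ring

theorem isRegularEndpoint (h : HasPowerBehaviour p q w β P Q W) (hβ : -1 < β) (hβ0 : β < 0) :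
    IsRegularEndpoint p q w 0 1 0 := by
  obtain ⟨_, A, _, _, hp⟩ := h.exists_inv_p_bounds
  obtain ⟨B, _, hq⟩ := h.exists_q_bound
  obtain ⟨κ, C, hκ, _, hw⟩ := h.exists_w_bounds
  have hhalf : (1 / 2 : ℝ) ∈ Ioo (0 : ℝ) 1 := by norm_num
  refine ⟨integrableAtFilter_zero_of_norm_le_rpow
      (h.continuousOn_p.inv₀ fun t ht => (h.p_pos t ht).ne') hhalf (by linarith : -1 < -β - 1)
      (C := A) fun t ht => ?_,
    integrableAtFilter_zero_of_norm_le_rpow h.continuousOn_q hhalf hβ hq,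
    integrableAtFilter_zero_of_norm_le_rpow h.continuousOn_w hhalf hβ (C := C) fun t ht => ?_⟩
  · rw [Real.norm_of_nonneg (inv_nonneg.2 (h.p_pos t ⟨ht.1, ht.2.trans hhalf.2⟩).le)]
    exact (hp t ht).2
  · rw [Real.norm_of_nonneg ((mul_nonneg hκ.le (Real.rpow_nonneg ht.1.le β)).trans (hw t ht).1)]
    exact (hw t ht).2

theorem not_isRegularEndpoint (h : HasPowerBehaviour p q w β P Q W) (hβ : 0 ≤ β) :
    ¬ IsRegularEndpoint p q w 0 1 0 := by
  obtain ⟨κ, _, hκ, _, hp⟩ := h.exists_inv_p_bounds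
  rintro ⟨hreg, -⟩
  exact not_integrableAtFilter_zero_of_rpow_le_norm (by norm_num : (0 : ℝ) < 1 / 2) hκ
    (by linarith : -β - 1 ≤ -1) (fun t ht => (hp t ht).1.trans (le_abs_self _)) hreg

/-- For `0 ≤ β < 1` every solution is `O(t ^ (-δ))` for an exponent `δ` slightly larger than `β`,
hence square integrable with weight `t ^ β`. The room between `β` and `δ` absorbs the logarithm
that occurs for `β = 0`. -/
theorem isLimitCircleEndpoint (h : HasPowerBehaviour p q w β P Q W) (hβ : 0 ≤ β) (hβ1 : β < 1) :
    IsLimitCircleEndpoint p q w 0 1 0 := by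
  refine ⟨h.not_isRegularEndpoint hβ, fun lam f hf => ?_⟩
  have hsys := hf.isSystemSolution h.continuousOn_p h.p_pos h.continuousOn_q h.continuousOn_w
  have hfcont : ContinuousOn f (Ioo 0 1) := hf.1.continuousOn
  set v : ℝ → ℂ := fun t => (p t : ℂ) * deriv f t
  obtain ⟨_, A, _, hA, hp⟩ := h.exists_inv_p_bounds
  obtain ⟨B, hB, hg⟩ := h.exists_potential_bound lam
  obtain ⟨κ, C, hκ, hC, hw⟩ := h.exists_w_bounds
  -- `2 * δ - β = (1 + β) / 2 < 1` makes `t ^ (β - 2 * δ)` integrable, and `δ - 1 / 2 ≤ β ≤ δ` lets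
  -- the bounds on the coefficients be weakened to those of `IsSystemSolution.norm_snd_sub_le`.
  set δ : ℝ := β + (1 - β) / 4 with hδdef
  have hδ : 0 < δ := by linarith
  obtain ⟨c, hc, hsmall⟩ := exists_small_mul_sqrt_le (2 * B * (A / δ))
  have hc1 : c ∈ Ioo (0 : ℝ) 1 := ⟨hc.1, by linarith [hc.2]⟩
  have hhalf : ∀ t ∈ Ioc 0 c, t ∈ Ioo (0 : ℝ) (1 / 2) := fun t ht => ⟨ht.1, ht.2.trans_lt hc.2⟩
  have hpow : ∀ t ∈ Ioc 0 c, ∀ r r' : ℝ, r' ≤ r → t ^ r ≤ t ^ r' := fun t ht r r' hr =>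
    Real.rpow_le_rpow_of_exponent_ge ht.1 (ht.2.trans hc1.2.le) hr
  have hp' : ∀ t ∈ Ioc 0 c, (p t)⁻¹ ≤ A * t ^ (-δ - 1) := fun t ht =>
    (hp t (hhalf t ht)).2.trans
      (mul_le_mul_of_nonneg_left (hpow t ht _ _ (by linarith)) hA.le)
  have hg' : ∀ t ∈ Ioc 0 c, ‖potential q w lam t‖ ≤ B * t ^ (δ - 1 / 2) := fun t ht =>
    (hg t (hhalf t ht)).trans (mul_le_mul_of_nonneg_left (hpow t ht _ _ (by linarith)) hB)
  set M : ℝ := ‖v c‖ + (‖v c‖ / 3 + 4 / 3 * (2 * B * c ^ (1 / 2 : ℝ) * ‖f c‖)) with hMdef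
  have hM : ∀ t ∈ Ioc 0 c, ‖v t‖ ≤ M := fun t ht => by
    have h1 := hsys.norm_snd_sub_le hδ hA.le hB hc1 h.p_pos hp' hg' hsmall ht
    have h2 := norm_sub_norm_le (v t) (v c)
    linarith
  set D : ℝ := ‖f c‖ + M * A / δ
  refine integrableAtFilter_zero_of_norm_le_rpow (C := D ^ 2 * C) (r := β - 2 * δ)
    ((hfcont.norm.pow 2).mul h.continuousOn_w) hc1 (by linarith) fun t ht => ?_
  have htc := Ioo_subset_Ioc_self ht
  have hft : ‖f t‖ ≤ D * t ^ (-δ) := hsys.norm_fst_le hδ hA.le hc1 h.p_pos hp' htc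
    fun s hs => hM s ⟨ht.1.trans_le hs.1, hs.2⟩
  have hwt := hw t (hhalf t htc)
  have hw0 : 0 ≤ w t := (mul_nonneg hκ.le (Real.rpow_nonneg ht.1.le β)).trans hwt.1
  rw [Real.norm_of_nonneg (by positivity)]
  calc ‖f t‖ ^ 2 * w t ≤ (D * t ^ (-δ)) ^ 2 * (C * t ^ β) :=
        mul_le_mul (pow_le_pow_left₀ (norm_nonneg _) hft 2) hwt.2 hw0 (sq_nonneg _)
    _ = D ^ 2 * C * (t ^ (-δ) * t ^ (-δ) * t ^ β) := by ring
    _ = D ^ 2 * C * t ^ (β - 2 * δ) := by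
        rw [← Real.rpow_add ht.1, ← Real.rpow_add ht.1]
        congr 2
        ring

/-- For `β ≥ 1` the solution with `f c = 0`, `(p f') c = 1` at a point `c` close to `0` has `p f'`
within `1 / 3` of `1` on `(0, c]`, so `|f|` is at least a multiple of `∫ 1 / p ~ t ^ (-β)` and
`|f| ^ 2 w` is at least a multiple of `t ^ (-β)`. -/
theorem isLimitPointEndpoint (h : HasPowerBehaviour p q w β P Q W) (hβ : 1 ≤ β) :
    IsLimitPointEndpoint p q w 0 1 0 := by
  have hβ0 : 0 < β := one_pos.trans_le hβ
  refine ⟨h.not_isRegularEndpoint hβ0.le, fun lam => ?_⟩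
  obtain ⟨a, A, ha, hA, hp⟩ := h.exists_inv_p_bounds
  obtain ⟨B, hB, hg⟩ := h.exists_potential_bound lam
  obtain ⟨κ, C, hκ, hC, hw⟩ := h.exists_w_bounds
  obtain ⟨c, hc, hsmall⟩ := exists_small_mul_sqrt_le (2 * B * (A / β))
  have hc1 : c ∈ Ioo (0 : ℝ) 1 := ⟨hc.1, by linarith [hc.2]⟩
  have hhalf : ∀ t ∈ Ioc 0 c, t ∈ Ioo (0 : ℝ) (1 / 2) := fun t ht => ⟨ht.1, ht.2.trans_lt hc.2⟩
  have hmem : ∀ t ∈ Ioc 0 c, t ∈ Ioo (0 : ℝ) 1 := fun t ht => ⟨ht.1, ht.2.trans_lt hc1.2⟩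
  obtain ⟨u, v, huc, hvc, hsys⟩ := exists_isSystemSolution (g := potential q w lam)
    h.continuousOn_p h.p_pos (continuousOn_potential h.continuousOn_q h.continuousOn_w) hc1 0 1
  refine ⟨u, hsys.isSolution h.continuousOn_p h.p_pos h.continuousOn_q h.continuousOn_w, ?_⟩
  have hg' : ∀ t ∈ Ioc 0 c, ‖potential q w lam t‖ ≤ B * t ^ (β - 1 / 2) := fun t ht =>
    (hg t (hhalf t ht)).trans (mul_le_mul_of_nonneg_left
      (Real.rpow_le_rpow_of_exponent_ge ht.1 (hmem t ht).2.le (by linarith)) hB)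
  have hv : ∀ t ∈ Ioc 0 c, 2 / 3 ≤ (v t).re := fun t ht => by
    have h1 := hsys.norm_snd_sub_le hβ0 hA.le hB hc1 h.p_pos
      (fun s hs => (hp s (hhalf s hs)).2) hg' hsmall ht
    rw [huc, hvc] at h1
    have h2 := (abs_le.1 ((Complex.abs_re_le_norm (v t - 1)).trans h1)).1
    norm_num at h2
    linarith
  -- `Re u + (2 a / (3 β)) t ^ (-β)` has nonnegative derivative, so its value at `t` is at most
  -- its value at `c`.
  set L : ℝ := 2 / 3 * a / β with hL
  have hL0 : 0 < L := by positivity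
  have hder : ∀ t ∈ Ioc 0 c, HasDerivAt (fun s => (u s).re + L * s ^ (-β))
      ((v t / (p t : ℂ)).re + L * (-β * t ^ (-β - 1))) t := fun t ht =>
    (Complex.reCLM.hasFDerivAt.comp_hasDerivAt t (hsys t (hmem t ht)).1).add
      ((Real.hasDerivAt_rpow_const (Or.inl ht.1.ne')).const_mul L)
  have hnonneg : ∀ t ∈ Ioc 0 c, 0 ≤ (v t / (p t : ℂ)).re + L * (-β * t ^ (-β - 1)) := by
    intro t ht
    have hp0 := h.p_pos t (hmem t ht)
    have h1 : 2 / 3 * (a * t ^ (-β - 1)) ≤ (v t).re * (p t)⁻¹ :=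
      mul_le_mul (hv t ht) (hp t (hhalf t ht)).1
        (mul_nonneg ha.le (Real.rpow_nonneg ht.1.le _)) (by linarith [hv t ht])
    have h2 : L * (-β * t ^ (-β - 1)) = -(2 / 3 * (a * t ^ (-β - 1))) := by
      rw [hL]
      field_simp
    rw [Complex.div_ofReal_re, h2, div_eq_mul_inv]
    linarith
  have hlower : ∀ t ∈ Ioc 0 c, L * (t ^ (-β) - c ^ (-β)) ≤ ‖u t‖ := by
    intro t ht
    have hsub : Icc t c ⊆ Ioc 0 c := fun s hs => ⟨ht.1.trans_le hs.1, hs.2⟩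
    have hmono : MonotoneOn (fun s => (u s).re + L * s ^ (-β)) (Icc t c) :=
      monotoneOn_of_hasDerivWithinAt_nonneg (convex_Icc t c)
        (fun s hs => (hder s (hsub hs)).continuousAt.continuousWithinAt)
        (fun s hs => (hder s (hsub (interior_subset hs))).hasDerivWithinAt)
        (fun s hs => hnonneg s (hsub (interior_subset hs)))
    have h1 := hmono (left_mem_Icc.2 ht.2) (right_mem_Icc.2 ht.2) ht.2
    simp only [huc, Complex.zero_re] at h1
    have h2 := (abs_le.1 (Complex.abs_re_le_norm (u t))).1
    linarith
  have hu : ∀ t ∈ Ioo 0 (c / 2), L / 2 * t ^ (-β) ≤ ‖u t‖ := by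
    intro t ht
    have h1 : c ^ (-β) ≤ 2⁻¹ * t ^ (-β) := by
      calc c ^ (-β) ≤ (2 * t) ^ (-β) :=
            Real.rpow_le_rpow_of_nonpos (by linarith [ht.1]) (by linarith [ht.2]) (by linarith)
        _ = (2 : ℝ) ^ (-β) * t ^ (-β) := Real.mul_rpow (by norm_num) ht.1.le
        _ ≤ 2⁻¹ * t ^ (-β) := by
            refine mul_le_mul_of_nonneg_right ?_ (Real.rpow_nonneg ht.1.le _)
            rw [← Real.rpow_neg_one]
            exact Real.rpow_le_rpow_of_exponent_le (by norm_num) (by linarith)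
    have h2 := hlower t ⟨ht.1, by linarith [ht.2, hc.1]⟩
    have h3 := mul_le_mul_of_nonneg_left h1 hL0.le
    linarith
  refine not_integrableAtFilter_zero_of_rpow_le_norm (half_pos hc.1)
    (by positivity : 0 < (L / 2) ^ 2 * κ) (by linarith : -β ≤ -1) fun t ht => ?_
  have hwt := (hw t (hhalf t ⟨ht.1, by linarith [ht.2, hc.1]⟩)).1
  refine le_trans ?_ (le_abs_self _)
  have hnn : 0 ≤ L / 2 * t ^ (-β) := mul_nonneg (half_pos hL0).le (Real.rpow_nonneg ht.1.le _)
  calc (L / 2) ^ 2 * κ * t ^ (-β) = (L / 2 * t ^ (-β)) ^ 2 * (κ * t ^ β) := by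
        have : t ^ (-β) * t ^ β = 1 := by rw [← Real.rpow_add ht.1]; simp
        linear_combination (-(L / 2) ^ 2 * κ * t ^ (-β)) * this
    _ ≤ ‖u t‖ ^ 2 * w t :=
        mul_le_mul (pow_le_pow_left₀ hnn (hu t ht) 2) hwt
          (mul_nonneg hκ.le (Real.rpow_nonneg ht.1.le _)) (sq_nonneg _)

end HasPowerBehaviour

/-! ### Reflection of the interval -/

theorem integrableAtFilter_one_iff_reflect {E : Type*} [NormedAddCommGroup E] {F : ℝ → E} :
    IntegrableAtFilter F (𝓝[Ioo (0 : ℝ) 1] 1) volume ↔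
      IntegrableAtFilter (fun t => F (1 - t)) (𝓝[Ioo (0 : ℝ) 1] 0) volume := by
  have hmap : Filter.map (fun t : ℝ => 1 - t) (𝓝[Ioo (0 : ℝ) 1] 0) = 𝓝[Ioo (0 : ℝ) 1] 1 := by
    simp
  have hvol : Measure.map (fun t : ℝ => 1 - t) volume = volume :=
    (volume.measurePreserving_sub_left (1 : ℝ)).map_eq
  have h := (Homeomorph.subLeft (1 : ℝ)).measurableEmbedding.integrableAtFilter_map_iff
    (f := F) (l := 𝓝[Ioo (0 : ℝ) 1] 0) (μ := volume)
  simp only [Homeomorph.coe_subLeft, hmap, hvol] at h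
  exact h

/-- The sign of `v` changes because `v = p u'` contains one derivative. -/
theorem IsSystemSolution.reflect {p : ℝ → ℝ} {g u v : ℝ → ℂ} (h : IsSystemSolution p g 0 1 u v) :
    IsSystemSolution (fun t => p (1 - t)) (fun t => g (1 - t)) 0 1
      (fun t => u (1 - t)) (fun t => -v (1 - t)) := fun t ht => by
  obtain ⟨h1, h2⟩ := h (1 - t) ⟨by linarith [ht.2], by linarith [ht.1]⟩
  refine ⟨(h1.comp_const_sub 1 t).congr_deriv ?_, (h2.comp_const_sub 1 t).neg.congr_deriv ?_⟩ <;>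
  ring

section Reflect

variable {p q w : ℝ → ℝ}

theorem continuousOn_reflect (hp : ContinuousOn p (Ioo 0 1)) :
    ContinuousOn (fun t => p (1 - t)) (Ioo 0 1) :=
  hp.comp (by fun_prop) fun t ht => ⟨by linarith [ht.2], by linarith [ht.1]⟩

theorem IsSolution.reflect (hp : ContinuousOn p (Ioo 0 1)) (hp0 : ∀ t ∈ Ioo (0 : ℝ) 1, 0 < p t)
    (hq : ContinuousOn q (Ioo 0 1)) (hw : ContinuousOn w (Ioo 0 1)) {lam : ℂ} {f : ℝ → ℂ}
    (hf : IsSolution p q w 0 1 lam f) :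
    IsSolution (fun t => p (1 - t)) (fun t => q (1 - t)) (fun t => w (1 - t)) 0 1 lam
      (fun t => f (1 - t)) :=
  (hf.isSystemSolution hp hp0 hq hw).reflect.isSolution (continuousOn_reflect hp)
    (fun t ht => hp0 (1 - t) ⟨by linarith [ht.2], by linarith [ht.1]⟩) (continuousOn_reflect hq)
    (continuousOn_reflect hw)

theorem isRegularEndpoint_one_iff_reflect : IsRegularEndpoint p q w 0 1 1 ↔
    IsRegularEndpoint (fun t => p (1 - t)) (fun t => q (1 - t)) (fun t => w (1 - t)) 0 1 0 := by
  simp only [IsRegularEndpoint, integrableAtFilter_one_iff_reflect]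

theorem isL2Near_one_iff_reflect {f : ℝ → ℂ} : IsL2Near w 0 1 1 f ↔
    IsL2Near (fun t => w (1 - t)) 0 1 0 (fun t => f (1 - t)) :=
  integrableAtFilter_one_iff_reflect

theorem isLimitCircleEndpoint_one_of_reflect (hp : ContinuousOn p (Ioo 0 1))
    (hp0 : ∀ t ∈ Ioo (0 : ℝ) 1, 0 < p t) (hq : ContinuousOn q (Ioo 0 1))
    (hw : ContinuousOn w (Ioo 0 1))
    (h : IsLimitCircleEndpoint (fun t => p (1 - t)) (fun t => q (1 - t)) (fun t => w (1 - t))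
      0 1 0) : IsLimitCircleEndpoint p q w 0 1 1 :=
  ⟨fun hreg => h.1 (isRegularEndpoint_one_iff_reflect.1 hreg), fun lam _ hf =>
    isL2Near_one_iff_reflect.2 (h.2 lam _ (hf.reflect hp hp0 hq hw))⟩

theorem isLimitPointEndpoint_one_of_reflect (hp : ContinuousOn p (Ioo 0 1))
    (hp0 : ∀ t ∈ Ioo (0 : ℝ) 1, 0 < p t) (hq : ContinuousOn q (Ioo 0 1))
    (hw : ContinuousOn w (Ioo 0 1))
    (h : IsLimitPointEndpoint (fun t => p (1 - t)) (fun t => q (1 - t)) (fun t => w (1 - t))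
      0 1 0) : IsLimitPointEndpoint p q w 0 1 1 := by
  refine ⟨fun hreg => h.1 (isRegularEndpoint_one_iff_reflect.1 hreg), fun lam => ?_⟩
  obtain ⟨f, hf, hf2⟩ := h.2 lam
  have hp0' : ∀ t ∈ Ioo (0 : ℝ) 1, 0 < p (1 - t) := fun t ht =>
    hp0 (1 - t) ⟨by linarith [ht.2], by linarith [ht.1]⟩
  have hrefl := hf.reflect (continuousOn_reflect hp) hp0' (continuousOn_reflect hq)
    (continuousOn_reflect hw)
  simp only [sub_sub_cancel] at hrefl
  refine ⟨_, hrefl, fun hL2 => hf2 ?_⟩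
  simpa only [sub_sub_cancel] using isL2Near_one_iff_reflect.1 hL2

end Reflect

end SturmLiouville

/-! ### The radial Schrödinger coefficients -/

namespace RadialSchrodinger

open SturmLiouville

theorem normConst_pos {R : ℝ} (hR : 0 < R) (k : ℕ) : 0 < normConst R k := by
  unfold normConst
  positivity

/-- Writing `k = n + 2` turns the integer power in the weight into a natural power. -/
theorem weight_add_two (R : ℝ) (n : ℕ) (t : ℝ) :
    weight R (n + 2) t =
      normConst R (n + 2) * t ^ (((n : ℝ) - 1) / 2) * (1 - t) ^ n * (1 + t) := by
  have h1 : (((n + 2 : ℕ) : ℝ) - 3) / 2 = ((n : ℝ) - 1) / 2 := by push_cast; ring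
  have h2 : ((n + 2 : ℕ) : ℤ) - 2 = (n : ℤ) := by push_cast; ring
  rw [weight, h1, h2, zpow_natCast]

section Coefficients

variable {R : ℝ} (n : ℕ)

theorem continuousOn_weight : ContinuousOn (weight R (n + 2)) (Ioo 0 1) := by
  rw [funext (weight_add_two R n)]
  have h : ContinuousOn (fun t : ℝ => t ^ (((n : ℝ) - 1) / 2)) (Ioo 0 1) :=
    continuousOn_id.rpow_const fun t ht => Or.inl ht.1.ne'
  fun_prop

theorem weight_pos (hR : 0 < R) {t : ℝ} (ht : t ∈ Ioo (0 : ℝ) 1) : 0 < weight R (n + 2) t := by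
  rw [weight_add_two]
  have h1 := normConst_pos hR (n + 2)
  have h2 : 0 < 1 - t := sub_pos.2 ht.2
  have h3 := ht.1
  positivity

theorem continuousOn_coeffP : ContinuousOn (coeffP R (n + 2)) (Ioo 0 1) := by
  have h := continuousOn_weight (R := R) n
  unfold coeffP
  fun_prop

theorem continuousOn_coeffQ : ContinuousOn (coeffQ R (n + 2)) (Ioo 0 1) := by
  have h := continuousOn_weight (R := R) n
  unfold coeffQ
  fun_prop

theorem coeffP_pos (hR : 0 < R) {t : ℝ} (ht : t ∈ Ioo (0 : ℝ) 1) : 0 < coeffP R (n + 2) t := by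
  have h1 := weight_pos n hR ht
  have h2 : 0 < 1 - t := sub_pos.2 ht.2
  have h3 := ht.1
  unfold coeffP
  positivity

/-- At `t = 0` the exponent is `(k - 3) / 2`, which is `(n - 1) / 2` for `k = n + 2`. -/
theorem hasPowerBehaviour_zero (hR : 0 < R) :
    HasPowerBehaviour (coeffP R (n + 2)) (coeffQ R (n + 2)) (weight R (n + 2)) (((n : ℝ) - 1) / 2)
      (fun t => 4 / R ^ 2 * (1 - t) * (normConst R (n + 2) * (1 - t) ^ n * (1 + t)))
      (fun t => R ^ 2 * (1 - t) * (normConst R (n + 2) * (1 - t) ^ n * (1 + t)))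
      (fun t => normConst R (n + 2) * (1 - t) ^ n * (1 + t)) where
  continuousOn_p := continuousOn_coeffP n
  continuousOn_q := continuousOn_coeffQ n
  continuousOn_w := continuousOn_weight n
  p_pos _ ht := coeffP_pos n hR ht
  continuousOn_P := by fun_prop
  continuousOn_Q := by fun_prop
  continuousOn_W := by fun_prop
  P_pos t ht := by
    have h1 := normConst_pos hR (n + 2)
    have h2 : 0 < 1 - t := by linarith [ht.2]
    have h3 := ht.1
    positivity
  W_pos t ht := by
    have h1 := normConst_pos hR (n + 2)
    have h2 : 0 < 1 - t := by linarith [ht.2]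
    have h3 := ht.1
    positivity
  p_eq t ht := by
    rw [coeffP, weight_add_two, Real.rpow_add_one ht.1.ne']
    ring
  q_eq t _ := by
    rw [coeffQ, weight_add_two]
    ring
  w_eq t _ := by
    rw [weight_add_two]
    ring

/-- At `t = 1` the exponent is `k - 2 = n`; the singular factor `t ^ ((k - 3) / 2)` of the weight
becomes part of the cofactors. -/
theorem hasPowerBehaviour_one (hR : 0 < R) :
    HasPowerBehaviour (fun t => coeffP R (n + 2) (1 - t)) (fun t => coeffQ R (n + 2) (1 - t))
      (fun t => weight R (n + 2) (1 - t)) n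
      (fun t => 4 / R ^ 2 * (1 - t) *
        (normConst R (n + 2) * (1 - t) ^ (((n : ℝ) - 1) / 2) * (2 - t)))
      (fun t => R ^ 2 * t * (normConst R (n + 2) * (1 - t) ^ (((n : ℝ) - 1) / 2) * (2 - t)))
      (fun t => normConst R (n + 2) * (1 - t) ^ (((n : ℝ) - 1) / 2) * (2 - t)) := by
  have hcont : ContinuousOn (fun t : ℝ => (1 - t) ^ (((n : ℝ) - 1) / 2)) (Icc 0 (1 / 2)) :=
    ContinuousOn.rpow_const (by fun_prop) fun t ht => Or.inl (by linarith [ht.2])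
  refine
    { continuousOn_p := continuousOn_reflect (continuousOn_coeffP n)
      continuousOn_q := continuousOn_reflect (continuousOn_coeffQ n)
      continuousOn_w := continuousOn_reflect (continuousOn_weight n)
      p_pos := fun t ht => coeffP_pos n hR ⟨by linarith [ht.2], by linarith [ht.1]⟩
      continuousOn_P := by fun_prop
      continuousOn_Q := by fun_prop
      continuousOn_W := by fun_prop
      P_pos := fun t ht => ?_
      W_pos := fun t ht => ?_
      p_eq := fun t ht => ?_
      q_eq := fun t _ => ?_
      w_eq := fun t _ => ?_ }
  · have h1 := normConst_pos hR (n + 2)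
    have h2 : 0 < 1 - t := by linarith [ht.2]
    have h3 : 0 < 2 - t := by linarith [ht.2]
    positivity
  · have h1 := normConst_pos hR (n + 2)
    have h2 : 0 < 1 - t := by linarith [ht.2]
    have h3 : 0 < 2 - t := by linarith [ht.2]
    positivity
  · rw [coeffP, weight_add_two, Real.rpow_add_one ht.1.ne', Real.rpow_natCast, sub_sub_cancel]
    ring
  · rw [coeffQ, weight_add_two, Real.rpow_natCast, sub_sub_cancel]
    ring
  · rw [weight_add_two, Real.rpow_natCast, sub_sub_cancel]
    ring

end Coefficients

end RadialSchrodinger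

theorem mainTheorem8 (R : ℝ) (hR : 0 < R) (k : ℕ) (hk : 2 ≤ k) :
    ((k = 2 → SturmLiouville.IsRegularEndpoint (RadialSchrodinger.coeffP R k)
        (RadialSchrodinger.coeffQ R k) (RadialSchrodinger.weight R k) 0 1 0) ∧
      (k = 3 ∨ k = 4 → SturmLiouville.IsLimitCircleEndpoint (RadialSchrodinger.coeffP R k)
        (RadialSchrodinger.coeffQ R k) (RadialSchrodinger.weight R k) 0 1 0) ∧
      (5 ≤ k → SturmLiouville.IsLimitPointEndpoint (RadialSchrodinger.coeffP R k)
        (RadialSchrodinger.coeffQ R k) (RadialSchrodinger.weight R k) 0 1 0)) ∧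
    ((k = 2 → SturmLiouville.IsLimitCircleEndpoint (RadialSchrodinger.coeffP R k)
        (RadialSchrodinger.coeffQ R k) (RadialSchrodinger.weight R k) 0 1 1) ∧
      (3 ≤ k → SturmLiouville.IsLimitPointEndpoint (RadialSchrodinger.coeffP R k)
        (RadialSchrodinger.coeffQ R k) (RadialSchrodinger.weight R k) 0 1 1)) := by
  obtain ⟨n, rfl⟩ := Nat.exists_eq_add_of_le' hk
  have h0 := RadialSchrodinger.hasPowerBehaviour_zero n hR
  have h1 := RadialSchrodinger.hasPowerBehaviour_one n hR
  refine ⟨⟨fun hn => ?_, fun hn => ?_, fun hn => ?_⟩, fun hn => ?_, fun hn => ?_⟩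
  · obtain rfl : n = 0 := by omega
    exact h0.isRegularEndpoint (by norm_num) (by norm_num)
  · have hn1 : (1 : ℝ) ≤ n := by exact_mod_cast (by omega : 1 ≤ n)
    have hn2 : (n : ℝ) ≤ 2 := by exact_mod_cast (by omega : n ≤ 2)
    exact h0.isLimitCircleEndpoint (by linarith) (by linarith)
  · have hn3 : (3 : ℝ) ≤ n := by exact_mod_cast (by omega : 3 ≤ n)
    exact h0.isLimitPointEndpoint (by linarith)
  · obtain rfl : n = 0 := by omega
    exact SturmLiouville.isLimitCircleEndpoint_one_of_reflect h0.continuousOn_p h0.p_pos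
      h0.continuousOn_q h0.continuousOn_w (h1.isLimitCircleEndpoint (by norm_num) (by norm_num))
  · have hn1 : (1 : ℝ) ≤ n := by exact_mod_cast (by omega : 1 ≤ n)
    exact SturmLiouville.isLimitPointEndpoint_one_of_reflect h0.continuousOn_p h0.p_pos
      h0.continuousOn_q h0.continuousOn_w (h1.isLimitPointEndpoint hn1)
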